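/- There is an absolute constant $c>0$ such that the following holds for every $n\ge 0$. Let $f:\{0,1\}^{\binom n2}\to\{0,1\}$ be a nontrivial monotone graph property of $n$-vertex graphs; that is, the input bits $x_e$ of $f$ are indexed by the unordered pairs $e=\{i,j\}$ of distinct vertices $i,j\in[n]$ (the bit $x_e$ tells whether $e$ is an edge, so the input is the adjacency matrix of a simple graph), and - $f$ is invariant under all permutations of the vertices (graph property), - $x\le y$ coordinatewise implies $f(x)\le f(y)$ (monotone), - $f(x)\ne f(y)$ for some inputs $x,y$ (nontrivial). Then $Q(f)\ge c\,n$. Here $Q(f)$ is the bounded-error quantum query complexity of $f$: the minimum $T$ such that some $T$-query quantum algorithm outputs $f(x)$ with probability at least $2/3$ on every input $x$. A $T$-query quantum algorithm applies $U_T O_x U_{T-1}O_x\cdots O_x U_0$ to a fixed basis state, where $U_0,\dots,U_T$ are unitaries independent of $x$ on a finite-dimensional space with basis states $|i,b,w\rangle$ ($i$ an input index or a dummy "no query" index $\bot$ with $x_\bot:=0$, $b\in\{0,1\}$, $w$ in a finite set), and $O_x|i,b,w\rangle=|i,b\oplus x_i,w\rangle$; it then measures in this basis, and its output bit is a fixed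 function of the outcome. -/

import Mathlib

/-- Computational basis of the register of a quantum query algorithm whose input bits are indexed
by `ι`: a query index (`none` is the index of the "no query" basis states), an answer qubit,
and a work register with basis `W`. -/
abbrev QueryBasis (ι W : Type) : Type := Option ι × Bool × W

/-- The value of the input string at a query index; the dummy index `none` always reads `0`. -/
def inputBit {ι : Type} (x : ι → Bool) : Option ι → Bool
  | none => false
  | some i => x i

/-- The classical map `(i, b, w) ↦ (i, b ⊕ xᵢ, w)` on basis states. -/
def queryMap {ι W : Type} (x : ι → Bool) (s : QueryBasis ι W) : QueryBasis ι W :=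
  (s.1, xor s.2.1 (inputBit x s.1), s.2.2)

/-- The query oracle `O_x : |i, b, w⟩ ↦ |i, b ⊕ xᵢ, w⟩`, as a (permutation) matrix. -/
def oracleMatrix {ι W : Type} [DecidableEq ι] [DecidableEq W] (x : ι → Bool) :
    Matrix (QueryBasis ι W) (QueryBasis ι W) ℂ :=
  Matrix.of fun r s => if r = queryMap x s then 1 else 0

/-- A quantum query algorithm on inputs `x : ι → Bool`, with finite-dimensional work space.
It applies `U T * O_x * U (T - 1) * ⋯ * O_x * U 0` to the basis state `start`, where
`T = queries`, measures in the computational basis, and outputs the bit `output s` if the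
measurement outcome is `s`. (Only `U 0, …, U T` matter; they do not depend on `x`.) -/
structure QuantumQueryAlgorithm (ι : Type) [Fintype ι] [DecidableEq ι] where
  /-- basis of the work register -/
  Work : Type
  /-- the work register is finite-dimensional -/
  [fintypeWork : Fintype Work]
  [decidableEqWork : DecidableEq Work]
  /-- number of queries -/
  queries : ℕ
  /-- initial basis state -/
  start : QueryBasis ι Work
  /-- the input-independent unitaries between the queries -/
  U : ℕ → Matrix.unitaryGroup (QueryBasis ι Work) ℂ
  /-- output bit as a function of the measurement outcome -/
  output : QueryBasis ι Work → Bool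

attribute [instance] QuantumQueryAlgorithm.fintypeWork QuantumQueryAlgorithm.decidableEqWork

namespace QuantumQueryAlgorithm

variable {ι : Type} [Fintype ι] [DecidableEq ι]

/-- The state of the algorithm on input `x` after `t` queries (and the unitary `U t`). -/
noncomputable def state (A : QuantumQueryAlgorithm ι) (x : ι → Bool) :
    ℕ → QueryBasis ι A.Work → ℂ
  | 0 => (A.U 0).1.mulVec (Pi.single A.start 1)
  | t + 1 => (A.U (t + 1)).1.mulVec ((oracleMatrix x).mulVec (A.state x t))

/-- The probability that the algorithm outputs the bit `v` on input `x`. -/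
noncomputable def outputProb (A : QuantumQueryAlgorithm ι) (x : ι → Bool) (v : Bool) : ℝ :=
  ∑ s : QueryBasis ι A.Work, if A.output s = v then ‖A.state x A.queries s‖ ^ 2 else 0

/-- `A` computes `f` with bounded error: on every input it is correct with probability at
least `2/3`. -/
def ComputesWithBoundedError (A : QuantumQueryAlgorithm ι) (f : (ι → Bool) → Bool) : Prop :=
  ∀ x : ι → Bool, 2 / 3 ≤ A.outputProb x (f x)

end QuantumQueryAlgorithm

/-- The bounded-error quantum query complexity `Q(f)` of a Boolean function: the minimum number
of queries of a quantum query algorithm that computes `f` with bounded error. -/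
noncomputable def quantumQueryComplexity {ι : Type} [Fintype ι] [DecidableEq ι]
    (f : (ι → Bool) → Bool) : ℕ :=
  sInf {T : ℕ | ∃ A : QuantumQueryAlgorithm ι, A.queries = T ∧ A.ComputesWithBoundedError f}

/-- The unordered pairs `{i, j}` of distinct vertices in `Fin n`; there are `n.choose 2`. -/
abbrev VertexPair (n : ℕ) : Type := {e : Sym2 (Fin n) // ¬ e.IsDiag}

/-- The action of a permutation of the vertices on unordered pairs, `{i, j} ↦ {σ i, σ j}`. -/
def relabelPair {n : ℕ} (σ : Equiv.Perm (Fin n)) (e : VertexPair n) : VertexPair n :=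
  ⟨Sym2.map σ e.1, fun h => e.2 ((Sym2.isDiag_map σ.injective).1 h)⟩

/-- `f`, a function of the adjacency bits of an `n`-vertex simple graph, is a graph property:
it is invariant under all permutations of the vertices. -/
def IsGraphProperty {n : ℕ} (f : (VertexPair n → Bool) → Bool) : Prop :=
  ∀ (σ : Equiv.Perm (Fin n)) (x : VertexPair n → Bool), f (fun e => x (relabelPair σ e)) = f x

/-- `f` is nontrivial: it is not constant. -/
def IsNontrivial {ι : Type} (f : (ι → Bool) → Bool) : Prop :=
  ∃ x y : ι → Bool, f x ≠ f y



theorem mapMatrix_mulVec_single {S : Type} [Fintype S] [DecidableEq S] (g : S → S) (s : S) :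
    (Matrix.of fun r s => if r = g s then (1 : ℂ) else 0).mulVec (Pi.single s 1) =
      Pi.single (g s) 1 := by
  ext r
  simp [Pi.single_apply]

theorem mapMatrix_mem_unitaryGroup {S : Type} [Fintype S] [DecidableEq S] (g : S → S)
    (hg : Function.Injective g) :
    (Matrix.of fun r s => if r = g s then (1 : ℂ) else 0) ∈ Matrix.unitaryGroup S ℂ := by
  rw [Matrix.mem_unitaryGroup_iff']
  ext r s
  simp [Matrix.mul_apply, Matrix.star_apply, Matrix.one_apply, hg.eq_iff, eq_comm]

theorem oracleMatrix_mem_unitaryGroup {ι W : Type} [Fintype ι] [DecidableEq ι] [Fintype W]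
    [DecidableEq W] (x : ι → Bool) :
    oracleMatrix x ∈ Matrix.unitaryGroup (QueryBasis ι W) ℂ := by
  refine mapMatrix_mem_unitaryGroup (queryMap x) ?_
  have h : Function.Involutive (queryMap (W := W) x) := by
    rintro ⟨i, b, w⟩
    simp [queryMap]
  exact h.injective

/-- Swap the answer qubit with the work bit at the query index, then permute the indices. -/
def storeMap {ι : Type} [DecidableEq ι] (τ : Equiv.Perm (Option ι))
    (s : QueryBasis ι (ι → Bool)) : QueryBasis ι (ι → Bool) :=
  (τ s.1, match s.1 with
    | none => s.2
    | some i => (s.2.2 i, Function.update s.2.2 i s.2.1))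

theorem storeMap_injective {ι : Type} [DecidableEq ι] (τ : Equiv.Perm (Option ι)) :
    Function.Injective (storeMap τ) := by
  rintro ⟨i, b, w⟩ ⟨j, c, v⟩ h
  simp only [storeMap, Prod.mk.injEq, EmbeddingLike.apply_eq_iff_eq] at h
  obtain ⟨rfl, h⟩ := h
  cases i with
  | none => simpa using h
  | some i =>
    simp only [Prod.mk.injEq] at h
    obtain ⟨h1, h2⟩ := h
    have hb : b = c := by simpa using congrFun h2 i
    refine Prod.ext rfl (Prod.ext hb (funext fun k => ?_))
    by_cases hk : k = i
    · subst hk; exact h1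
    · simpa [hk] using congrFun h2 k

/-- Every Boolean function on finitely many bits is computed by some quantum query algorithm
(query all bits), so the minimum defining the quantum query complexity is attained. -/
theorem exists_algorithm {ι : Type} [Fintype ι] [DecidableEq ι] (f : (ι → Bool) → Bool) :
    ∃ A : QuantumQueryAlgorithm ι, A.ComputesWithBoundedError f := by
  let N := Fintype.card ι
  let e : ι ≃ Fin N := Fintype.equivFin ι
  let q : ℕ → Option ι := fun t => if h : t < N then some (e.symm ⟨t, h⟩) else none
  let τ : ℕ → Equiv.Perm (Option ι) := fun t =>
    match t with
    | 0 => 1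
    | t + 1 => Equiv.swap (q t) (q (t + 1))
  let u : ℕ → Matrix.unitaryGroup (QueryBasis ι (ι → Bool)) ℂ := fun t =>
    match t with
    | 0 => 1
    | t + 1 => ⟨_, mapMatrix_mem_unitaryGroup _ (storeMap_injective (τ (t + 1)))⟩
  let A : QuantumQueryAlgorithm ι :=
    { Work := ι → Bool
      queries := N
      start := (q 0, false, fun _ => false)
      U := u
      output := fun s => f s.2.2 }
  have key : ∀ (x : ι → Bool) (t : ℕ), t ≤ N → A.state x t =
      Pi.single ((q t, false, fun i => if (e i : ℕ) < t then x i else false) :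
        QueryBasis ι (ι → Bool)) 1 := by
    intro x t
    induction t with
    | zero =>
      intro _
      simp only [Nat.not_lt_zero, if_false]
      exact Matrix.one_mulVec _
    | succ t ih =>
      intro ht
      have hq : q t = some (e.symm ⟨t, ht⟩) := by simp only [q]; rw [dif_pos]
      rw [QuantumQueryAlgorithm.state, ih (by omega)]
      erw [mapMatrix_mulVec_single, mapMatrix_mulVec_single]
      congr 1
      simp only [queryMap, storeMap, τ, hq, inputBit, Equiv.swap_apply_left, Prod.mk.injEq,
        true_and]
      refine ⟨by simp, funext fun i => ?_⟩
      by_cases hi : i = e.symm ⟨t, ht⟩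
      · subst hi; simp
      · have : (e i : ℕ) ≠ t := by
          intro h
          exact hi (by rw [Equiv.eq_symm_apply]; exact Fin.ext h)
        have h2 : ((e i : ℕ) < t + 1) ↔ (e i : ℕ) < t := by omega
        simp [hi, h2]
  refine ⟨A, fun x => ?_⟩
  have hx := key x N le_rfl
  have hw : (fun i => if (e i : ℕ) < N then x i else false) = x := by
    funext i; simp
  rw [hw] at hx
  rw [QuantumQueryAlgorithm.outputProb]
  change 2 / 3 ≤ ∑ s, if A.output s = f x then ‖A.state x N s‖ ^ 2 else 0
  rw [hx]
  rw [Finset.sum_eq_single ((q N, false, x) : QueryBasis ι (ι → Bool))]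
  · simp [A]; norm_num
  · intro s _ hs
    rw [Pi.single_eq_of_ne hs]; simp
  · intro h; exact absurd (Finset.mem_univ _) h

/-- The minimum defining the quantum query complexity is attained. -/
theorem exists_algorithm_queries_eq {ι : Type} [Fintype ι] [DecidableEq ι]
    (f : (ι → Bool) → Bool) : ∃ A : QuantumQueryAlgorithm ι,
      A.queries = quantumQueryComplexity f ∧ A.ComputesWithBoundedError f := by
  have h : {T : ℕ | ∃ A : QuantumQueryAlgorithm ι,
      A.queries = T ∧ A.ComputesWithBoundedError f}.Nonempty := by
    obtain ⟨A, hA⟩ := exists_algorithm f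
    exact ⟨_, A, rfl, hA⟩
  exact Nat.sInf_mem h

/-!
# A linear lower bound for the quantum query complexity of monotone graph properties

The bound comes from the sensitivity graph of a subfunction: the graph on the inputs `z` of the
subfunction `g` in which two inputs are joined if they differ in one bit and `g` differs.

*A transitive subfunction.* Let `2 ^ (k + 1)` be the largest power of two that is at most `n`.
Making vertices isolated or dominating, one at a time, reduces the property to `2 ^ (k + 1)`
vertices, unless at some point every such step trivializes it. In the first case the argument of
Rivest and Vuillemin applies: in the chain of disjoint unions of cliques of sizes `1, 2, 4, …`, some
doubling of the cliques makes the property true, and the edges between the two halves of the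
doubled cliques form a complete bipartite pattern. In the second case a clique with isolated
vertices violates the property and a spanning star satisfies it, which gives such a pattern again
(`exists_pattern`). Fixing all other bits leaves a function `g` of `4 ^ k` bits with
`g 0 = false`, `g 1 = true` and a transitive symmetry group. As the number of bits is a power of
two, double counting shows that `g` is true an odd number of times
(`odd_card_true_of_transitive`), so `g` has full degree.

*Huang's theorem.* Full degree means that `g` agrees with parity, or with its negation, on more than
half of the hypercube, and every edge inside the agreement set is sensitive. The eigenspace of
Huang's signed adjacency matrix for the eigenvalue `√N`, where `N = 4 ^ k`, has half the full
dimension, so it contains a vector supported on the agreement set. Its absolute value shows that the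
sensitivity graph has spectral norm at least `√N = 2 ^ k`
(`exists_sensitivity_rayleigh_ge_sqrt`).

*The adversary method.* With such a vector `v` as weights, the sum over sensitive edges of the inner
products of the states of the algorithm starts at `√N * ‖v‖²` at least, must lose the fraction
`1 / 18` of its value by the end, and changes by at most `2 * ‖v‖²` per query
(`QuantumQueryAlgorithm.rayleigh_le_queries`). Hence `2 ^ k ≤ 36 * T`, while `n < 4 * 2 ^ k`.
-/

/-! ### Flipping an input bit -/

/-- The input obtained from `x` by flipping its `k`-th bit. -/
def flipBit {κ : Type} [DecidableEq κ] (k : κ) (x : κ → Bool) : κ → Bool :=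
  Function.update x k (!x k)

section flipBit

variable {κ : Type} [DecidableEq κ]

theorem flipBit_self (k : κ) (x : κ → Bool) : flipBit k x k = !x k := by simp [flipBit]

theorem flipBit_of_ne {k l : κ} (h : l ≠ k) (x : κ → Bool) : flipBit k x l = x l := by
  simp [flipBit, h]

theorem flipBit_flipBit (k : κ) (x : κ → Bool) : flipBit k (flipBit k x) = x := by
  ext l
  by_cases h : l = k
  · subst h; simp [flipBit_self]
  · simp [flipBit_of_ne h]

theorem flipBit_comm (k l : κ) (x : κ → Bool) :
    flipBit k (flipBit l x) = flipBit l (flipBit k x) := by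
  by_cases h : k = l
  · rw [h]
  ext j
  by_cases hk : j = k
  · subst hk; simp [flipBit_self, flipBit_of_ne h]
  by_cases hl : j = l
  · subst hl; simp [flipBit_self, flipBit_of_ne hk]
  · simp [flipBit_of_ne hk, flipBit_of_ne hl]

theorem sum_flipBit [Fintype κ] {M : Type} [AddCommMonoid M] (k : κ) (F : (κ → Bool) → M) :
    ∑ x, F (flipBit k x) = ∑ x, F x :=
  Fintype.sum_bijective (flipBit k)
    (Function.Involutive.bijective (flipBit_flipBit k)) _ _ fun _ => rfl

end flipBit

/-! ### Transitive functions on `2 ^ m` bits -/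

/-- Double counting of the pairs `(x, k)` with `x ∈ S` and `x k = true`: by transitivity the number
of such pairs is the same for every `k`. -/
theorem card_dvd_weight_mul_card {κ : Type} [Fintype κ] [DecidableEq κ]
    (S : Finset (κ → Bool)) (w : ℕ)
    (hw : ∀ x ∈ S, (Finset.univ.filter fun k => x k = true).card = w)
    (hS : ∀ k l : κ, ∃ τ : Equiv.Perm κ, τ k = l ∧ ∀ x, x ∘ τ ∈ S ↔ x ∈ S) :
    Fintype.card κ ∣ w * S.card := by
  have h1 : w * S.card = ∑ k : κ, (S.filter fun x => x k = true).card := by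
    have : ∑ k : κ, (S.filter fun x => x k = true).card
        = ∑ x ∈ S, (Finset.univ.filter fun k => x k = true).card := by
      simp only [Finset.card_filter]
      exact Finset.sum_comm
    rw [this, Finset.sum_congr rfl hw, Finset.sum_const, smul_eq_mul, mul_comm]
  have h2 : ∀ k l : κ, (S.filter fun x => x k = true).card
      = (S.filter fun x => x l = true).card := by
    intro k l
    obtain ⟨τ, hτ, hx⟩ := hS k l
    symm
    refine Finset.card_bij (fun x _ => x ∘ τ) ?_ ?_ ?_
    · intro x h
      simp only [Finset.mem_filter] at h ⊢
      exact ⟨(hx x).2 h.1, by simpa [hτ] using h.2⟩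
    · intro x _ y _ h
      exact τ.surjective.injective_comp_right h
    · intro y h
      have hy : (y ∘ τ.symm) ∘ τ = y := by ext; simp
      simp only [Finset.mem_filter] at h
      refine ⟨y ∘ τ.symm, ?_, hy⟩
      simp only [Finset.mem_filter]
      refine ⟨(hx _).1 (by rw [hy]; exact h.1), ?_⟩
      simpa [← hτ] using h.2
  rw [h1]
  rcases isEmpty_or_nonempty κ with h | ⟨⟨k⟩⟩
  · simp
  · rw [Finset.sum_congr rfl fun l _ => h2 l k]
    simp

/-- A function of `2 ^ m` bits with a transitive symmetry group that separates the two constant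
inputs takes the value `true` an odd number of times: by double counting, the weight classes
`0 < w < 2 ^ m` contribute even numbers. -/
theorem odd_card_true_of_transitive {κ : Type} [Fintype κ] [DecidableEq κ] {m : ℕ}
    (hκ : Fintype.card κ = 2 ^ m) (g : (κ → Bool) → Bool)
    (hg : ∀ k l : κ, ∃ τ : Equiv.Perm κ, τ k = l ∧ ∀ x, g (x ∘ τ) = g x)
    (h0 : g (fun _ => false) = false) (h1 : g (fun _ => true) = true) :
    Odd (Finset.univ.filter fun x => g x = true).card := by
  set S := Finset.univ.filter fun x => g x = true with hSdef
  let wt : (κ → Bool) → ℕ := fun x => (Finset.univ.filter fun k => x k = true).card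
  have hfib : S.card = ∑ w ∈ Finset.range (2 ^ m + 1), (S.filter fun x => wt x = w).card := by
    refine Finset.card_eq_sum_card_fiberwise ?_
    intro x _
    have : wt x ≤ 2 ^ m := hκ ▸ Finset.card_le_univ _
    simpa [Nat.lt_succ_iff] using this
  have hfull : (S.filter fun x => wt x = 2 ^ m) = {fun _ => true} := by
    ext x
    simp only [Finset.mem_filter, Finset.mem_singleton, hSdef, Finset.mem_univ, true_and, wt]
    constructor
    · rintro ⟨_, h⟩
      rw [← hκ, Finset.card_eq_iff_eq_univ] at h
      ext k
      simpa using (Finset.ext_iff.1 h k).2 (Finset.mem_univ k)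
    · rintro rfl
      simp [h1, hκ]
  have heven : ∀ w ∈ Finset.range (2 ^ m), Even (S.filter fun x => wt x = w).card := by
    intro w hw
    rcases Nat.eq_zero_or_pos w with rfl | hpos
    · have : (S.filter fun x => wt x = 0) = ∅ := by
        ext x
        simp only [Finset.mem_filter, hSdef, Finset.mem_univ, true_and, wt,
          Finset.card_eq_zero, Finset.notMem_empty, iff_false, not_and]
        intro hx h
        have : x = fun _ => false := by
          ext k
          have := Finset.ext_iff.1 h k
          simpa using this
        rw [this, h0] at hx
        exact absurd hx (by simp)
      simp [this]
    · have hd : 2 ^ m ∣ w * (S.filter fun x => wt x = w).card := by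
        rw [← hκ]
        refine card_dvd_weight_mul_card _ w (fun x hx => (Finset.mem_filter.1 hx).2) ?_
        intro k l
        obtain ⟨τ, hτ, hx⟩ := hg k l
        refine ⟨τ, hτ, fun x => ?_⟩
        have : wt (x ∘ τ) = wt x := by
          simp only [wt]
          refine Finset.card_bij (fun k _ => τ k) (by simp) (by simp) ?_
          intro k hk
          exact ⟨τ.symm k, by simpa using hk, by simp⟩
        simp [hSdef, hx, this]
      by_contra hodd
      rw [Nat.not_even_iff_odd] at hodd
      have hc : Nat.Coprime (2 ^ m) (S.filter fun x => wt x = w).card :=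
        Nat.Coprime.pow_left _ (Nat.coprime_two_left.2 hodd)
      have := Nat.le_of_dvd hpos (hc.dvd_of_dvd_mul_right hd)
      exact absurd (Finset.mem_range.1 hw) (by omega)
  rw [hfib, Finset.sum_range_succ, hfull, Finset.card_singleton]
  exact (Finset.even_sum _ heven).add_one

/-! ### Huang's signed hypercube -/

section signs

variable {κ : Type}

theorem prod_sign_flipBit_of_mem [DecidableEq κ] {s : Finset κ} {k : κ} (hk : k ∈ s)
    (x : κ → Bool) :
    ∏ j ∈ s, (if flipBit k x j then (-1 : ℝ) else 1) = -∏ j ∈ s, if x j then (-1 : ℝ) else 1 := by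
  rw [← Finset.mul_prod_erase s _ hk, ← Finset.mul_prod_erase s _ hk]
  have : ∏ j ∈ s.erase k, (if flipBit k x j then (-1 : ℝ) else 1)
      = ∏ j ∈ s.erase k, if x j then (-1 : ℝ) else 1 :=
    Finset.prod_congr rfl fun j hj => by rw [flipBit_of_ne (Finset.ne_of_mem_erase hj)]
  rw [this, flipBit_self]
  cases x k <;> simp

theorem prod_sign_flipBit_of_notMem [DecidableEq κ] {s : Finset κ} {k : κ} (hk : k ∉ s)
    (x : κ → Bool) :
    ∏ j ∈ s, (if flipBit k x j then (-1 : ℝ) else 1) = ∏ j ∈ s, if x j then (-1 : ℝ) else 1 :=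
  Finset.prod_congr rfl fun j hj => by rw [flipBit_of_ne (by rintro rfl; exact hk hj)]

theorem prod_sign_mul_self (s : Finset κ) (x : κ → Bool) :
    (∏ j ∈ s, if x j then (-1 : ℝ) else 1) * (∏ j ∈ s, if x j then (-1 : ℝ) else 1) = 1 := by
  rw [← Finset.prod_mul_distrib]
  exact Finset.prod_eq_one fun j _ => by cases x j <;> simp

end signs

section Huang

variable {κ : Type} [Fintype κ]

/-- The parity character `(-1) ^ |x|`. -/
def paritySign (x : κ → Bool) : ℝ := ∏ k, if x k then -1 else 1

/-- Huang's sign of the edge of the hypercube at `x` in direction `k`: the parity of the bits of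
`x` that precede `k`, where the bits are ordered by their rank `r`. -/
def edgeSign (r : κ → ℕ) (k : κ) (x : κ → Bool) : ℝ :=
  ∏ j ∈ Finset.univ.filter (fun j => r j < r k), if x j then -1 else 1

theorem paritySign_mul_self (x : κ → Bool) : paritySign x * paritySign x = 1 :=
  prod_sign_mul_self _ x

theorem abs_edgeSign (r : κ → ℕ) (k : κ) (x : κ → Bool) : |edgeSign r k x| = 1 := by
  have h : edgeSign r k x * edgeSign r k x = 1 := prod_sign_mul_self _ x
  rcases mul_self_eq_one_iff.1 h with h | h <;> simp [h]

/-- Multiplication by the parity character, a linear automorphism. -/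
def parityEquiv : ((κ → Bool) → ℝ) ≃ₗ[ℝ] ((κ → Bool) → ℝ) :=
  LinearEquiv.ofInvolutive
    { toFun := fun v x => paritySign x * v x
      map_add' := fun u v => by ext x; simp [mul_add]
      map_smul' := fun c v => by ext x; simp; ring }
    (fun v => by ext x; simp [← mul_assoc, paritySign_mul_self])

theorem parityEquiv_apply (v : (κ → Bool) → ℝ) (x : κ → Bool) :
    parityEquiv v x = paritySign x * v x := rfl

variable [DecidableEq κ]

/-- Huang's signed adjacency operator of the hypercube. -/
def signedAdj (r : κ → ℕ) : ((κ → Bool) → ℝ) →ₗ[ℝ] ((κ → Bool) → ℝ) where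
  toFun v x := ∑ k, edgeSign r k x * v (flipBit k x)
  map_add' u v := by
    ext x
    simp [mul_add, Finset.sum_add_distrib]
  map_smul' c v := by
    ext x
    simp only [Pi.smul_apply, smul_eq_mul, RingHom.id_apply, Finset.mul_sum]
    exact Finset.sum_congr rfl fun k _ => by ring

theorem signedAdj_apply (r : κ → ℕ) (v : (κ → Bool) → ℝ) (x : κ → Bool) :
    signedAdj r v x = ∑ k, edgeSign r k x * v (flipBit k x) := rfl

theorem paritySign_flipBit (k : κ) (x : κ → Bool) :
    paritySign (flipBit k x) = -paritySign x :=
  prod_sign_flipBit_of_mem (Finset.mem_univ k) x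

theorem edgeSign_flipBit_of_lt {r : κ → ℕ} {k l : κ} (h : r k < r l) (x : κ → Bool) :
    edgeSign r l (flipBit k x) = -edgeSign r l x :=
  prod_sign_flipBit_of_mem (by simpa using h) x

theorem edgeSign_flipBit_of_le {r : κ → ℕ} {k l : κ} (h : r l ≤ r k) (x : κ → Bool) :
    edgeSign r l (flipBit k x) = edgeSign r l x :=
  prod_sign_flipBit_of_notMem (by simpa using h) x

/-- The square of the signed adjacency operator is the scalar `N`: the signs are chosen so that
every 4-cycle of the hypercube has negative sign. -/
theorem signedAdj_signedAdj {r : κ → ℕ} (hr : Function.Injective r) (v : (κ → Bool) → ℝ) :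
    signedAdj r (signedAdj r v) = (Fintype.card κ : ℝ) • v := by
  ext x
  let F : κ → κ → ℝ := fun k l =>
    edgeSign r k x * edgeSign r l (flipBit k x) * v (flipBit l (flipBit k x))
  have hdiag : ∀ k, F k k = v x := by
    intro k
    simp only [F, edgeSign_flipBit_of_le le_rfl, flipBit_flipBit]
    rw [show edgeSign r k x * edgeSign r k x = 1 from prod_sign_mul_self _ x, one_mul]
  have hlt : ∀ k l, r k < r l → F k l + F l k = 0 := by
    intro k l h
    simp only [F, edgeSign_flipBit_of_lt h, edgeSign_flipBit_of_le h.le, flipBit_comm l k]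
    ring
  have hoff : ∀ k l, F k l + F l k = if k = l then 2 * v x else 0 := by
    intro k l
    split_ifs with h
    · subst h; rw [hdiag]; ring
    · rcases lt_or_gt_of_ne (fun h' => h (hr h')) with h' | h'
      · exact hlt k l h'
      · rw [add_comm]; exact hlt l k h'
  have hsum : signedAdj r (signedAdj r v) x = ∑ k, ∑ l, F k l := by
    simp only [signedAdj_apply, Finset.mul_sum, F, mul_assoc]
  have h2 : (∑ k, ∑ l, F k l) + ∑ k, ∑ l, F k l = 2 * (Fintype.card κ * v x) := by
    have hswap : ∑ k, ∑ l, F k l = ∑ k, ∑ l, F l k := Finset.sum_comm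
    nth_rw 2 [hswap]
    simp only [← Finset.sum_add_distrib, hoff]
    simp
    ring
  rw [hsum, Pi.smul_apply, smul_eq_mul]
  linarith

theorem signedAdj_parityEquiv (r : κ → ℕ) (v : (κ → Bool) → ℝ) :
    signedAdj r (parityEquiv v) = -parityEquiv (signedAdj r v) := by
  ext x
  simp only [signedAdj_apply, parityEquiv_apply, paritySign_flipBit, Pi.neg_apply, Finset.mul_sum,
    ← Finset.sum_neg_distrib]
  exact Finset.sum_congr rfl fun k _ => by ring

/-- The eigenspaces of the signed adjacency operator for `√N` and `-√N` span the whole space and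
are exchanged by the parity character, so each has at least half the dimension. -/
theorem card_le_two_mul_finrank_ker {r : κ → ℕ} (hr : Function.Injective r) [Nonempty κ] :
    Fintype.card (κ → Bool) ≤
      2 * Module.finrank ℝ
        (LinearMap.ker (signedAdj r - Real.sqrt (Fintype.card κ) • LinearMap.id)) := by
  set s := Real.sqrt (Fintype.card κ) with hs
  have hss : s * s = Fintype.card κ := Real.mul_self_sqrt (Nat.cast_nonneg _)
  have hpos : 0 < s := Real.sqrt_pos.2 (by exact_mod_cast Fintype.card_pos)
  set P := LinearMap.ker (signedAdj r - s • LinearMap.id) with hP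
  have hmemP : ∀ v, v ∈ P ↔ signedAdj r v = s • v := by
    intro v
    simp [hP, LinearMap.mem_ker, sub_eq_zero]
  set M := P.map (parityEquiv (κ := κ)).toLinearMap with hM
  have hrank : Module.finrank ℝ M = Module.finrank ℝ P :=
    LinearEquiv.finrank_map_eq parityEquiv P
  have htop : P ⊔ M = ⊤ := by
    rw [eq_top_iff]
    intro v _
    rw [Submodule.mem_sup]
    have hA := signedAdj_signedAdj hr v
    refine ⟨(2 * s)⁻¹ • (s • v + signedAdj r v), ?_, (2 * s)⁻¹ • (s • v - signedAdj r v), ?_, ?_⟩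
    · rw [hmemP, map_smul, map_add, map_smul, hA, ← hss]
      module
    · refine ⟨parityEquiv ((2 * s)⁻¹ • (s • v - signedAdj r v)), ?_, ?_⟩
      · rw [SetLike.mem_coe, hmemP, signedAdj_parityEquiv, ← map_neg, ← map_smul]
        congr 1
        rw [map_smul, map_sub, map_smul, hA, ← hss]
        module
      · ext x
        simp only [LinearEquiv.coe_coe, parityEquiv_apply]
        rw [← mul_assoc, paritySign_mul_self, one_mul]
    · rw [← smul_add, show s • v + signedAdj r v + (s • v - signedAdj r v) = (2 * s) • v by module,
        smul_smul, inv_mul_cancel₀ (by positivity), one_smul]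
  have h1 := Submodule.finrank_add_le_finrank_add_finrank P M
  rw [htop, finrank_top, Module.finrank_fintype_fun_eq_card, hrank] at h1
  omega

/-- Huang's theorem in spectral form: if more than half of the vertices of the hypercube lie in
`S`, then the subgraph induced on `S` has a nonzero nonnegative test vector whose Rayleigh
quotient is at least `√N`. -/
theorem exists_rayleigh_ge_sqrt [Nonempty κ] (S : Finset (κ → Bool))
    (hS : Fintype.card (κ → Bool) < 2 * S.card) :
    ∃ v : (κ → Bool) → ℝ, (∀ x, 0 ≤ v x) ∧ (∀ x, x ∉ S → v x = 0) ∧ 0 < ∑ x, v x ^ 2 ∧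
      Real.sqrt (Fintype.card κ) * ∑ x, v x ^ 2 ≤ ∑ x, ∑ k, v x * v (flipBit k x) := by
  classical
  let r : κ → ℕ := fun k => (Fintype.equivFin κ k : ℕ)
  have hr : Function.Injective r := Fin.val_injective.comp (Fintype.equivFin κ).injective
  set s := Real.sqrt (Fintype.card κ) with hs
  set P := LinearMap.ker (signedAdj r - s • LinearMap.id) with hP
  have hdim : Fintype.card (κ → Bool) ≤ 2 * Module.finrank ℝ P := card_le_two_mul_finrank_ker hr
  -- restriction to the complement of `S` cannot be injective on the eigenspace
  let ρ : P →ₗ[ℝ] ({x // x ∉ S} → ℝ) :=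
    (LinearMap.funLeft ℝ ℝ (Subtype.val : {x // x ∉ S} → (κ → Bool))).comp P.subtype
  have hlt : Module.finrank ℝ ({x // x ∉ S} → ℝ) < Module.finrank ℝ P := by
    have hc : Fintype.card {x // x ∉ S} = Fintype.card (κ → Bool) - S.card := by
      rw [Fintype.card_subtype_compl]; simp
    have := Finset.card_le_univ S
    rw [Module.finrank_fintype_fun_eq_card, hc]
    omega
  obtain ⟨⟨u, huP⟩, hu0, hne⟩ :=
    Submodule.exists_mem_ne_zero_of_ne_bot (LinearMap.ker_ne_bot_of_finrank_lt (f := ρ) hlt)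
  have hu : signedAdj r u = s • u := by
    simpa [hP, LinearMap.mem_ker, sub_eq_zero] using huP
  have hsupp : ∀ x, x ∉ S → u x = 0 := by
    intro x hx
    have := congrFun (LinearMap.mem_ker.1 hu0) ⟨x, hx⟩
    simpa [ρ, LinearMap.funLeft] using this
  have hune : u ≠ 0 := fun h => hne (Subtype.ext h)
  refine ⟨fun x => |u x|, fun x => abs_nonneg _, fun x hx => by simp [hsupp x hx], ?_, ?_⟩
  · obtain ⟨x, hx⟩ := Function.ne_iff.1 hune
    exact Finset.sum_pos' (fun x _ => by positivity)
      ⟨x, Finset.mem_univ _, by have : u x ≠ 0 := hx; positivity⟩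
  · rw [Finset.mul_sum]
    refine Finset.sum_le_sum fun x _ => ?_
    have hx : s * u x = ∑ k, edgeSign r k x * u (flipBit k x) := by
      rw [← signedAdj_apply, hu, Pi.smul_apply, smul_eq_mul]
    calc s * |u x| ^ 2 = u x * (s * u x) := by rw [sq_abs]; ring
      _ = ∑ k, u x * (edgeSign r k x * u (flipBit k x)) := by rw [hx, Finset.mul_sum]
      _ ≤ ∑ k, |u x| * |u (flipBit k x)| := Finset.sum_le_sum fun k _ => by
          refine (le_abs_self _).trans_eq ?_
          rw [abs_mul, abs_mul, abs_edgeSign, one_mul]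

theorem sum_paritySign [Nonempty κ] : ∑ x : κ → Bool, paritySign x = 0 := by
  obtain ⟨k⟩ := ‹Nonempty κ›
  have h := sum_flipBit k (paritySign (κ := κ))
  simp only [paritySign_flipBit, Finset.sum_neg_distrib] at h
  linarith

/-- If `g` is `true` an odd number of times, then `g` has full degree, that is, it agrees with
the parity function (or its negation) on more than half of the inputs. All edges of the hypercube
inside the agreement set are sensitive for `g`, so Huang's theorem bounds the spectral norm of the
sensitivity graph of `g` from below. -/
theorem exists_sensitivity_rayleigh_ge_sqrt [Nonempty κ] (g : (κ → Bool) → Bool)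
    (hg : Odd (Finset.univ.filter fun x => g x = true).card) :
    ∃ v : (κ → Bool) → ℝ, (∀ x, 0 ≤ v x) ∧ 0 < ∑ x, v x ^ 2 ∧
      Real.sqrt (Fintype.card κ) * ∑ x, v x ^ 2 ≤
        ∑ x, ∑ k, if g x ≠ g (flipBit k x) then v x * v (flipBit k x) else 0 := by
  classical
  -- `χ x = 1` exactly when `g x` is the parity bit of `x`
  let χ : (κ → Bool) → ℝ := fun x => paritySign x * if g x then -1 else 1
  have hχ : ∀ x, χ x = 1 ∨ χ x = -1 := by
    intro x
    rcases mul_self_eq_one_iff.1 (paritySign_mul_self x) with h | h <;>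
      cases hx : g x <;> simp [χ, h, hx]
  have key : ∀ ε : ℝ, ε ≠ 0 →
      Fintype.card (κ → Bool) < 2 * (Finset.univ.filter fun x => χ x = ε).card →
      ∃ v : (κ → Bool) → ℝ, (∀ x, 0 ≤ v x) ∧ 0 < ∑ x, v x ^ 2 ∧
      Real.sqrt (Fintype.card κ) * ∑ x, v x ^ 2 ≤
        ∑ x, ∑ k, if g x ≠ g (flipBit k x) then v x * v (flipBit k x) else 0 := by
    intro ε hε hcard
    obtain ⟨v, hv0, hvS, hpos, hle⟩ := exists_rayleigh_ge_sqrt _ hcard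
    refine ⟨v, hv0, hpos, hle.trans_eq ?_⟩
    refine Finset.sum_congr rfl fun x _ => Finset.sum_congr rfl fun k _ => ?_
    split_ifs with h
    · rfl
    · rw [not_not] at h
      by_cases hx : χ x = ε
      · have : χ (flipBit k x) ≠ ε := by
          have : χ (flipBit k x) = -ε := by
            rw [← hx]; simp only [χ, paritySign_flipBit, ← h]; ring
          rw [this]
          intro h'
          exact hε (by linarith)
        rw [hvS (flipBit k x) (by simpa using this), mul_zero]
      · rw [hvS x (by simpa using hx), zero_mul]
  have hneg : (Finset.univ.filter fun x => χ x = -1)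
      = Finset.univ.filter fun x => ¬ χ x = 1 := by
    refine Finset.filter_congr fun x _ => ?_
    rcases hχ x with h | h <;> norm_num [h]
  have hadd := Finset.card_filter_add_card_filter_not (s := Finset.univ) (fun x => χ x = 1)
  rw [← hneg, Finset.card_univ] at hadd
  have hne : (Finset.univ.filter fun x => χ x = 1).card
      ≠ (Finset.univ.filter fun x => χ x = -1).card := by
    intro heq
    have h1 : ∑ x, χ x = 0 := by
      have : ∀ x, χ x = (if χ x = 1 then (1 : ℝ) else 0) - (if χ x = -1 then (1 : ℝ) else 0) := by
        intro x
        rcases hχ x with h | h <;> norm_num [h]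
      rw [Finset.sum_congr rfl fun x _ => this x, Finset.sum_sub_distrib, Finset.sum_boole,
        Finset.sum_boole, heq, sub_self]
    have h2 : ∑ x, χ x = -2 * ∑ x, if g x = true then paritySign x else 0 := by
      have : ∀ x, χ x = paritySign x + -2 * if g x = true then paritySign x else 0 := by
        intro x
        cases hx : g x <;> simp [χ, hx]
        ring
      rw [Finset.sum_congr rfl fun x _ => this x, Finset.sum_add_distrib, sum_paritySign,
        ← Finset.mul_sum, zero_add]
    -- modulo `2` the parity character is `1`
    let p : (κ → Bool) → ℤ := fun x => ∏ k, if x k then -1 else 1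
    have hp : ∀ x, ((p x : ℤ) : ℝ) = paritySign x := by
      intro x
      simp only [p, paritySign, Int.cast_prod]
      exact Finset.prod_congr rfl fun k _ => by split_ifs <;> simp
    have h3 : ∑ x ∈ Finset.univ.filter (fun x => g x = true), p x = 0 := by
      have : ((∑ x ∈ Finset.univ.filter (fun x => g x = true), p x : ℤ) : ℝ) = 0 := by
        rw [Int.cast_sum, Finset.sum_filter]
        simp only [hp]
        linarith
      exact_mod_cast this
    have hodd : ∀ x, Odd (p x) := fun x =>
      Finset.prod_induction _ Odd (fun _ _ => Odd.mul) odd_one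
        (fun k _ => by split_ifs <;> decide)
    choose q hq using hodd
    rw [Finset.sum_congr rfl fun x _ => hq x, Finset.sum_add_distrib, ← Finset.mul_sum,
      Finset.sum_const, nsmul_eq_mul, mul_one] at h3
    obtain ⟨m, hm⟩ := hg
    rw [hm] at h3
    omega
  rcases lt_or_gt_of_ne hne with h | h
  · exact key (-1) (by norm_num) (by omega)
  · exact key 1 one_ne_zero (by omega)

end Huang

/-! ### The adversary bound for the sensitivity graph -/

section Adversary

theorem star_mulVec_dotProduct_mulVec {S : Type} [Fintype S] [DecidableEq S]
    (U : Matrix.unitaryGroup S ℂ) (φ ψ : S → ℂ) :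
    star (U.1.mulVec φ) ⬝ᵥ U.1.mulVec ψ = star φ ⬝ᵥ ψ := by
  rw [Matrix.star_mulVec, ← Matrix.dotProduct_mulVec, Matrix.mulVec_mulVec,
    ← Matrix.star_eq_conjTranspose, Unitary.coe_star_mul_self U, Matrix.one_mulVec]

theorem star_dotProduct_self {S : Type} [Fintype S] (φ : S → ℂ) :
    star φ ⬝ᵥ φ = ((∑ s, ‖φ s‖ ^ 2 : ℝ) : ℂ) := by
  simp only [dotProduct, Pi.star_apply, RCLike.star_def, Complex.conj_mul']
  push_cast
  rfl

theorem norm_sum_star_mul_le {S : Type} [Fintype S] (φ ψ : S → ℂ) (a b : ℝ) (ha : 0 ≤ a)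
    (hb : 0 ≤ b) :
    a * b * ‖∑ s, star (φ s) * ψ s‖ ≤ (a ^ 2 * ∑ s, ‖φ s‖ ^ 2 + b ^ 2 * ∑ s, ‖ψ s‖ ^ 2) / 2 := by
  calc a * b * ‖∑ s, star (φ s) * ψ s‖ ≤ a * b * ∑ s, ‖φ s‖ * ‖ψ s‖ := by
        gcongr
        refine (norm_sum_le _ _).trans_eq ?_
        simp
    _ ≤ (a ^ 2 * ∑ s, ‖φ s‖ ^ 2 + b ^ 2 * ∑ s, ‖ψ s‖ ^ 2) / 2 := by
        rw [Finset.mul_sum, Finset.mul_sum, Finset.mul_sum, ← Finset.sum_add_distrib,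
          Finset.sum_div]
        refine Finset.sum_le_sum fun s _ => ?_
        nlinarith [sq_nonneg (a * ‖φ s‖ - b * ‖ψ s‖)]

variable {ι : Type} {W : Type}

theorem queryMap_queryMap (x : ι → Bool) (s : QueryBasis ι W) :
    queryMap x (queryMap x s) = s := by
  obtain ⟨i, b, w⟩ := s
  simp [queryMap]

variable [Fintype W]

theorem sum_xor_bit (c : Bool) (F : Bool × W → ℂ) :
    ∑ s : Bool × W, F (xor s.1 c, s.2) = ∑ s, F s := by
  refine Fintype.sum_bijective (fun s : Bool × W => (xor s.1 c, s.2)) ?_ _ _ fun _ => rfl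
  refine Function.Involutive.bijective ?_
  rintro ⟨b, w⟩
  simp

/-- The probability that the query index of the state `φ` is `i`. -/
noncomputable def queryMass (φ : QueryBasis ι W → ℂ) (i : Option ι) : ℝ :=
  ∑ s : Bool × W, ‖φ (i, s)‖ ^ 2

theorem queryMass_nonneg (φ : QueryBasis ι W → ℂ) (i : Option ι) : 0 ≤ queryMass φ i :=
  Finset.sum_nonneg fun _ _ => by positivity

variable [Fintype ι]

theorem sum_queryMass (φ : QueryBasis ι W → ℂ) : ∑ i, queryMass φ i = ∑ s, ‖φ s‖ ^ 2 :=
  (Fintype.sum_prod_type fun s : QueryBasis ι W => ‖φ s‖ ^ 2).symm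

variable [DecidableEq ι] [DecidableEq W]

theorem oracleMatrix_mulVec (x : ι → Bool) (φ : QueryBasis ι W → ℂ) (s : QueryBasis ι W) :
    (oracleMatrix x).mulVec φ s = φ (queryMap x s) := by
  simp only [Matrix.mulVec, dotProduct, oracleMatrix, Matrix.of_apply]
  rw [Finset.sum_eq_single (queryMap x s)]
  · simp [queryMap_queryMap]
  · intro t _ ht
    rw [if_neg, zero_mul]
    rintro rfl
    exact ht (queryMap_queryMap x t).symm
  · simp

/-- One query changes the inner product of the states on two inputs that differ only at the index
`i` by no more than the masses of the two states at the index `i`. -/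
theorem oracle_step_le {x y : ι → Bool} {i : ι} (hxy : ∀ j, j ≠ i → x j = y j)
    (φ ψ : QueryBasis ι W → ℂ) {a b : ℝ} (ha : 0 ≤ a) (hb : 0 ≤ b) :
    a * b * ‖star φ ⬝ᵥ ψ - star ((oracleMatrix x).mulVec φ) ⬝ᵥ (oracleMatrix y).mulVec ψ‖ ≤
      a ^ 2 * queryMass φ (some i) + b ^ 2 * queryMass ψ (some i) := by
  let F : Option ι → ℂ := fun j => ∑ s : Bool × W, star (φ (j, s)) * ψ (j, s)
  let G : Option ι → ℂ := fun j => ∑ s : Bool × W,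
    star (φ (j, xor s.1 (inputBit x j), s.2)) * ψ (j, xor s.1 (inputBit y j), s.2)
  have hF : star φ ⬝ᵥ ψ = ∑ j, F j := Fintype.sum_prod_type _
  have hG : star ((oracleMatrix x).mulVec φ) ⬝ᵥ (oracleMatrix y).mulVec ψ = ∑ j, G j := by
    simp only [dotProduct, Pi.star_apply, oracleMatrix_mulVec]
    exact Fintype.sum_prod_type _
  have hFG : ∀ j, j ≠ some i → F j = G j := by
    intro j hj
    have : inputBit x j = inputBit y j := by
      cases j with
      | none => rfl
      | some j => exact hxy j fun h => hj (by rw [h])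
    simp only [F, G, this]
    exact (sum_xor_bit (inputBit y j) fun s => star (φ (j, s)) * ψ (j, s)).symm
  have hdiff : star φ ⬝ᵥ ψ - star ((oracleMatrix x).mulVec φ) ⬝ᵥ (oracleMatrix y).mulVec ψ
      = F (some i) - G (some i) := by
    rw [hF, hG, ← Finset.sum_sub_distrib]
    refine Finset.sum_eq_single _ (fun j _ hj => by rw [hFG j hj, sub_self]) (by simp)
  have hmass : ∀ (c : Bool) (θ : QueryBasis ι W → ℂ),
      ∑ s : Bool × W, ‖θ (some i, xor s.1 c, s.2)‖ ^ 2 = queryMass θ (some i) := by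
    intro c θ
    refine Fintype.sum_bijective (fun s : Bool × W => (xor s.1 c, s.2)) ?_ _ _ fun _ => rfl
    refine Function.Involutive.bijective ?_
    rintro ⟨b, w⟩
    simp
  have h1 : a * b * ‖F (some i)‖ ≤ _ := norm_sum_star_mul_le _ _ a b ha hb
  have h2 : a * b * ‖G (some i)‖ ≤ _ := norm_sum_star_mul_le _ _ a b ha hb
  rw [hmass, hmass] at h2
  rw [hdiff]
  calc a * b * ‖F (some i) - G (some i)‖ ≤ a * b * (‖F (some i)‖ + ‖G (some i)‖) := by
        gcongr; exact norm_sub_le _ _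
    _ ≤ _ := by
        rw [mul_add]
        refine (add_le_add h1 h2).trans_eq ?_
        simp only [queryMass]
        ring

namespace QuantumQueryAlgorithm

variable (A : QuantumQueryAlgorithm ι)

theorem star_state_zero_dotProduct (x y : ι → Bool) :
    star (A.state x 0) ⬝ᵥ A.state y 0 = 1 := by
  simp only [state]
  rw [star_mulVec_dotProduct_mulVec]
  simp

theorem star_state_succ_dotProduct (x y : ι → Bool) (t : ℕ) :
    star (A.state x (t + 1)) ⬝ᵥ A.state y (t + 1)
      = star ((oracleMatrix x).mulVec (A.state x t)) ⬝ᵥ (oracleMatrix y).mulVec (A.state y t) := by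
  simp only [state]
  rw [star_mulVec_dotProduct_mulVec]

theorem sum_norm_sq_state (x : ι → Bool) (t : ℕ) : ∑ s, ‖A.state x t s‖ ^ 2 = 1 := by
  have h : star (A.state x t) ⬝ᵥ A.state x t = 1 := by
    induction t with
    | zero => exact A.star_state_zero_dotProduct x x
    | succ t ih =>
      rw [star_state_succ_dotProduct]
      exact (star_mulVec_dotProduct_mulVec ⟨_, oracleMatrix_mem_unitaryGroup x⟩ _ _).trans ih
  rw [star_dotProduct_self] at h
  exact_mod_cast h

theorem outputProb_add_outputProb_not (x : ι → Bool) (v : Bool) :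
    A.outputProb x v + A.outputProb x (!v) = 1 := by
  rw [outputProb, outputProb, ← Finset.sum_add_distrib, ← A.sum_norm_sq_state x A.queries]
  refine Finset.sum_congr rfl fun s _ => ?_
  cases A.output s <;> cases v <;> simp

/-- Final states on inputs with different values are far from parallel. -/
theorem norm_star_state_dotProduct_le {f : (ι → Bool) → Bool} (hA : A.ComputesWithBoundedError f)
    {x y : ι → Bool} (hxy : f x ≠ f y) :
    ‖star (A.state x A.queries) ⬝ᵥ A.state y A.queries‖ ≤ 17 / 18 := by
  have hy : f y = !f x := by cases hx : f x <;> cases hy : f y <;> simp_all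
  have px := hA x
  have py := hA y
  have qx := A.outputProb_add_outputProb_not x (f x)
  have qy := A.outputProb_add_outputProb_not y (f x)
  rw [hy] at py
  -- AM-GM with weights `2/3` and `3/2`, the larger weight on the less likely outcome
  have hbound : ‖star (A.state x A.queries) ⬝ᵥ A.state y A.queries‖ ≤
      (2 / 3 * A.outputProb x (f x) + 3 / 2 * A.outputProb y (f x)
        + 3 / 2 * A.outputProb x (!f x) + 2 / 3 * A.outputProb y (!f x)) / 2 := by
    simp only [outputProb, Finset.mul_sum, ← Finset.sum_add_distrib, Finset.sum_div]
    refine (norm_sum_le _ _).trans (Finset.sum_le_sum fun s _ => ?_)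
    rw [norm_mul, Pi.star_apply, norm_star]
    set p := ‖A.state x A.queries s‖
    set q := ‖A.state y A.queries s‖
    cases A.output s <;> cases f x <;> simp <;>
      nlinarith [sq_nonneg (2 * p - 3 * q), sq_nonneg (3 * p - 2 * q)]
  linarith

/-- The spectral adversary bound for the sensitivity graph of a subfunction of `f`. The inputs
`X z` of the subfunction are parametrized by bit strings `z : κ → Bool`, and flipping the bit `k`
of `z` changes only the bit `e k` of `X z`. The progress measure is the sum of `v z * v z'` times
the inner product of the states on `X z` and `X z'`, over the sensitive edges `(z, z')`. -/
theorem rayleigh_le_queries {f : (ι → Bool) → Bool} (hA : A.ComputesWithBoundedError f)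
    {κ : Type} [Fintype κ] [DecidableEq κ] (X : (κ → Bool) → (ι → Bool)) (e : κ → ι)
    (he : Function.Injective e)
    (hX : ∀ z k j, j ≠ e k → X (flipBit k z) j = X z j)
    (v : (κ → Bool) → ℝ) (hv : ∀ z, 0 ≤ v z) :
    (∑ z, ∑ k, if f (X z) ≠ f (X (flipBit k z)) then v z * v (flipBit k z) else 0)
      ≤ 36 * A.queries * ∑ z, v z ^ 2 := by
  let c : (κ → Bool) → κ → ℝ := fun z k =>
    if f (X z) ≠ f (X (flipBit k z)) then v z * v (flipBit k z) else 0
  have hc0 : ∀ z k, 0 ≤ c z k := by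
    intro z k
    simp only [c]
    split_ifs
    · exact mul_nonneg (hv _) (hv _)
    · exact le_rfl
  have hcle : ∀ z k, c z k ≤ v z * v (flipBit k z) := by
    intro z k
    simp only [c]
    split_ifs
    · exact le_rfl
    · exact mul_nonneg (hv _) (hv _)
  let ip : ℕ → (κ → Bool) → κ → ℂ := fun t z k =>
    star (A.state (X z) t) ⬝ᵥ A.state (X (flipBit k z)) t
  let Φ : ℕ → ℂ := fun t => ∑ z, ∑ k, (c z k : ℂ) * ip t z k
  have hΦ0 : Φ 0 = ((∑ z, ∑ k, c z k : ℝ) : ℂ) := by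
    simp [Φ, ip, star_state_zero_dotProduct]
  have hΦT : ‖Φ A.queries‖ ≤ 17 / 18 * ∑ z, ∑ k, c z k := by
    rw [Finset.mul_sum]
    refine (norm_sum_le _ _).trans (Finset.sum_le_sum fun z _ => ?_)
    rw [Finset.mul_sum]
    refine (norm_sum_le _ _).trans (Finset.sum_le_sum fun k _ => ?_)
    rw [norm_mul, Complex.norm_real, Real.norm_of_nonneg (hc0 z k), mul_comm]
    by_cases h : f (X z) ≠ f (X (flipBit k z))
    · exact mul_le_mul_of_nonneg_right (A.norm_star_state_dotProduct_le hA h) (hc0 z k)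
    · rw [not_not] at h
      simp [c, h]
  have hmass : ∀ t z, ∑ k, queryMass (A.state (X z) t) (some (e k)) ≤ 1 := by
    intro t z
    rw [← A.sum_norm_sq_state (X z) t, ← sum_queryMass]
    have hinj : Function.Injective fun k => some (e k) := (Option.some_injective _).comp he
    rw [← Finset.sum_image (g := fun k => some (e k)) (s := Finset.univ)
      (f := fun i => queryMass (A.state (X z) t) i) hinj.injOn]
    exact Finset.sum_le_sum_of_subset_of_nonneg (Finset.subset_univ _)
      fun i _ _ => queryMass_nonneg _ i
  have hstep : ∀ t, ‖Φ t - Φ (t + 1)‖ ≤ 2 * ∑ z, v z ^ 2 := by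
    intro t
    let M : (κ → Bool) → κ → ℝ := fun z k =>
      v z ^ 2 * queryMass (A.state (X z) t) (some (e k))
    have h1 : ‖Φ t - Φ (t + 1)‖ ≤ ∑ z, ∑ k, (M z k + M (flipBit k z) k) := by
      simp only [Φ, ← Finset.sum_sub_distrib, ← mul_sub]
      refine (norm_sum_le _ _).trans (Finset.sum_le_sum fun z _ => ?_)
      refine (norm_sum_le _ _).trans (Finset.sum_le_sum fun k _ => ?_)
      rw [norm_mul, Complex.norm_real, Real.norm_of_nonneg (hc0 z k)]
      refine (mul_le_mul_of_nonneg_right (hcle z k) (norm_nonneg _)).trans ?_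
      simp only [ip, star_state_succ_dotProduct]
      exact oracle_step_le (fun j hj => (hX z k j hj).symm) _ _ (hv _) (hv _)
    have h2 : ∑ z, ∑ k, M (flipBit k z) k = ∑ z, ∑ k, M z k := by
      rw [Finset.sum_comm, Finset.sum_congr rfl fun k _ => sum_flipBit k fun z => M z k,
        Finset.sum_comm]
    have h3 : ∑ z, ∑ k, M z k ≤ ∑ z, v z ^ 2 := by
      refine Finset.sum_le_sum fun z _ => ?_
      simp only [M, ← Finset.mul_sum]
      exact mul_le_of_le_one_right (sq_nonneg _) (hmass t z)
    simp only [Finset.sum_add_distrib] at h1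
    linarith
  have htotal : ∀ t, ‖Φ 0 - Φ t‖ ≤ t * (2 * ∑ z, v z ^ 2) := by
    intro t
    induction t with
    | zero => simp
    | succ t ih =>
      calc ‖Φ 0 - Φ (t + 1)‖ = ‖(Φ 0 - Φ t) + (Φ t - Φ (t + 1))‖ := by congr 1; ring
        _ ≤ t * (2 * ∑ z, v z ^ 2) + 2 * ∑ z, v z ^ 2 :=
            (norm_add_le _ _).trans (add_le_add ih (hstep t))
        _ = _ := by push_cast; ring
  have hnn : 0 ≤ ∑ z, ∑ k, c z k :=
    Finset.sum_nonneg fun z _ => Finset.sum_nonneg fun k _ => hc0 z k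
  have hfin : ∑ z, ∑ k, c z k ≤ ‖Φ 0 - Φ A.queries‖ + ‖Φ A.queries‖ := by
    calc ∑ z, ∑ k, c z k = ‖Φ 0‖ := by
          rw [hΦ0, Complex.norm_real, Real.norm_of_nonneg hnn]
      _ ≤ _ := norm_le_norm_sub_add _ _
  have := htotal A.queries
  change ∑ z, ∑ k, c z k ≤ _
  linarith

end QuantumQueryAlgorithm

end Adversary

/-! ### Restricting a graph property to a complete bipartite pattern -/

section Graph

variable {V : Type}

/-- Every permutation of the vertices in `R` is an automorphism of `C`. -/
def IsSymmetricOn (C : SimpleGraph V) (R : Finset V) : Prop :=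
  ∀ σ : Equiv.Perm V, (∀ u, u ∉ R → σ u = u) → ∀ u v, C.Adj (σ u) (σ v) ↔ C.Adj u v

theorem mem_iff_of_fixes_compl {R : Finset V} {σ : Equiv.Perm V} (h : ∀ u, u ∉ R → σ u = u)
    (u : V) : σ u ∈ R ↔ u ∈ R := by
  constructor
  · intro hu
    by_contra hu'
    rw [h u hu'] at hu
    exact hu' hu
  · intro hu
    by_contra hu'
    have := σ.injective (h _ hu')
    rw [this] at hu'
    exact hu' hu

theorem IsSymmetricOn.mono {C : SimpleGraph V} {R R' : Finset V} (hC : IsSymmetricOn C R)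
    (h : R' ⊆ R) : IsSymmetricOn C R' :=
  fun σ hσ => hC σ fun u hu => hσ u fun hu' => hu (h hu')

/-- A graph `H` and disjoint vertex sets `A`, `B` of the same size `m` such that joining `A`
completely to `B` turns `H` from a non-member into a member of the property `F`, and such that the
automorphisms of `H` that preserve `A` and `B` act transitively on `A × B`. -/
def HasBipartitePattern (F : SimpleGraph V → Prop) (m : ℕ) : Prop :=
  ∃ (A B : Finset V) (H : SimpleGraph V), Disjoint A B ∧ A.card = m ∧ B.card = m ∧ ¬ F H ∧
    F (H ⊔ SimpleGraph.fromRel fun u v => u ∈ A ∧ v ∈ B) ∧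
    ∀ a ∈ A, ∀ a' ∈ A, ∀ b ∈ B, ∀ b' ∈ B, ∃ σ : Equiv.Perm V,
      (∀ u v, H.Adj (σ u) (σ v) ↔ H.Adj u v) ∧ (∀ u, σ u ∈ A ↔ u ∈ A) ∧
      (∀ u, σ u ∈ B ↔ u ∈ B) ∧ σ a = a' ∧ σ b = b'

/-- The complete graph on the vertex set `R`. -/
def cliqueOn (R : Finset V) : SimpleGraph V := SimpleGraph.fromRel fun u v => u ∈ R ∧ v ∈ R

/-- The star with centre `c` and leaves `R \ {c}`. -/
def starOn (c : V) (R : Finset V) : SimpleGraph V := SimpleGraph.fromRel fun u v => u = c ∧ v ∈ R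

theorem IsSymmetricOn.sup_starOn {C : SimpleGraph V} {R : Finset V} (hC : IsSymmetricOn C R)
    {c : V} (hc : c ∉ R) : IsSymmetricOn (C ⊔ starOn c R) R := by
  intro σ hσ u v
  have h1 : ∀ u, σ u = c ↔ u = c := fun u => by
    conv_lhs => rw [← hσ c hc]
    exact σ.injective.eq_iff
  simp only [SimpleGraph.sup_adj, hC σ hσ u v, starOn, SimpleGraph.fromRel_adj, ne_eq,
    σ.injective.eq_iff, h1, mem_iff_of_fixes_compl hσ]

variable [DecidableEq V]

/-- If no vertex of `R` can be made isolated or dominating without trivializing the property, then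
joining a set `B` of isolated vertices to a part `A` of the clique `R \ B` creates a star. -/
theorem exists_pattern_of_star {F : SimpleGraph V → Prop} (hF : Monotone F) {m : ℕ} (hm : 0 < m)
    {C : SimpleGraph V} {R : Finset V} (hC : IsSymmetricOn C R)
    (h0 : ∀ c ∈ R, ¬ F (C ⊔ cliqueOn (R.erase c))) (h1 : ∀ c ∈ R, F (C ⊔ starOn c R))
    (hR : 2 * m ≤ R.card) : HasBipartitePattern F m := by
  obtain ⟨A, hAR, hA⟩ := Finset.exists_subset_card_eq (s := R) (n := m) (by omega)
  obtain ⟨B, hBR, hB⟩ := Finset.exists_subset_card_eq (s := R \ A) (n := m)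
    (by rw [Finset.card_sdiff_of_subset hAR]; omega)
  have hdisj : Disjoint A B := (Finset.disjoint_sdiff).mono_right hBR
  have hBR' : B ⊆ R := hBR.trans Finset.sdiff_subset
  refine ⟨A, B, C ⊔ cliqueOn (R \ B), hdisj, hA, hB, ?_, ?_, ?_⟩
  · obtain ⟨c, hc⟩ := Finset.card_pos.1 (hB ▸ hm : 0 < B.card)
    refine fun h => h0 c (hBR' hc) (hF (sup_le_sup_left ?_ C) h)
    intro u v huv
    have hne : ∀ u, u ∈ R \ B → u ∈ R.erase c := fun u hu =>
      Finset.mem_erase.2 ⟨by rintro rfl; exact (Finset.mem_sdiff.1 hu).2 hc,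
        (Finset.mem_sdiff.1 hu).1⟩
    simp only [cliqueOn, SimpleGraph.fromRel_adj] at huv ⊢
    exact ⟨huv.1, huv.2.imp (fun h => ⟨hne _ h.1, hne _ h.2⟩) fun h => ⟨hne _ h.1, hne _ h.2⟩⟩
  · obtain ⟨c, hc⟩ := Finset.card_pos.1 (hA ▸ hm : 0 < A.card)
    refine hF ?_ (h1 c (hAR hc))
    rw [sup_assoc]
    refine sup_le_sup_left ?_ C
    have hcB : c ∈ R \ B := Finset.mem_sdiff.2 ⟨hAR hc, Finset.disjoint_left.1 hdisj hc⟩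
    intro u v huv
    simp only [cliqueOn, starOn, SimpleGraph.sup_adj, SimpleGraph.fromRel_adj,
      Finset.mem_sdiff] at huv hcB ⊢
    obtain ⟨hne, ⟨rfl, hv⟩ | ⟨rfl, hu⟩⟩ := huv
    · by_cases hvB : v ∈ B <;> tauto
    · by_cases huB : u ∈ B <;> tauto
  · intro a ha a' ha' b hb b' hb'
    have hAB := Finset.disjoint_left.1 hdisj
    have hσA : ∀ u ∈ A, (Equiv.swap a a' * Equiv.swap b b') u ∈ A ∧
        (Equiv.swap a a' * Equiv.swap b b') u = Equiv.swap a a' u := by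
      intro u hu
      have : Equiv.swap b b' u = u := Equiv.swap_apply_of_ne_of_ne
        (by rintro rfl; exact hAB hu hb) (by rintro rfl; exact hAB hu hb')
      rw [Equiv.Perm.mul_apply, this]
      refine ⟨?_, rfl⟩
      rw [Equiv.swap_apply_def]
      split_ifs <;> assumption
    have hσB : ∀ u ∈ B, (Equiv.swap a a' * Equiv.swap b b') u ∈ B ∧
        (Equiv.swap a a' * Equiv.swap b b') u = Equiv.swap b b' u := by
      intro u hu
      have hmem : Equiv.swap b b' u ∈ B := by
        rw [Equiv.swap_apply_def]
        split_ifs <;> assumption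
      have : Equiv.swap a a' (Equiv.swap b b' u) = Equiv.swap b b' u :=
        Equiv.swap_apply_of_ne_of_ne (fun h => hAB ha (h ▸ hmem)) fun h => hAB ha' (h ▸ hmem)
      rw [Equiv.Perm.mul_apply, this]
      exact ⟨hmem, rfl⟩
    have hσo : ∀ u, u ∉ A → u ∉ B → (Equiv.swap a a' * Equiv.swap b b') u = u := by
      intro u hu hu'
      rw [Equiv.Perm.mul_apply, Equiv.swap_apply_of_ne_of_ne (x := u) (a := b),
        Equiv.swap_apply_of_ne_of_ne]
      all_goals rintro rfl; contradiction
    set σ := Equiv.swap a a' * Equiv.swap b b' with hσ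
    have hσR : ∀ u, u ∉ R → σ u = u := fun u hu =>
      hσo u (fun h => hu (hAR h)) fun h => hu (hBR' h)
    have hmemA : ∀ u, σ u ∈ A ↔ u ∈ A := by
      intro u
      refine ⟨fun h => ?_, fun h => (hσA u h).1⟩
      by_contra hu
      by_cases huB : u ∈ B
      · exact hAB h (hσB u huB).1
      · rw [hσo u hu huB] at h; exact hu h
    have hmemB : ∀ u, σ u ∈ B ↔ u ∈ B := by
      intro u
      refine ⟨fun h => ?_, fun h => (hσB u h).1⟩
      by_contra hu
      by_cases huA : u ∈ A
      · exact hAB (hσA u huA).1 h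
      · rw [hσo u huA hu] at h; exact hu h
    refine ⟨σ, ?_, hmemA, hmemB, ?_, ?_⟩
    · intro u v
      simp only [SimpleGraph.sup_adj, hC σ hσR, cliqueOn, SimpleGraph.fromRel_adj, ne_eq,
        σ.injective.eq_iff, Finset.mem_sdiff, hmemB, mem_iff_of_fixes_compl hσR]
    · rw [(hσA a ha).2, Equiv.swap_apply_left]
    · rw [(hσB b hb).2, Equiv.swap_apply_left]

/-- The union of disjoint cliques on `R`, labelled by `{0,1}^k`, whose vertices agree in all
coordinates `≥ i`; the cliques have `2 ^ i` vertices. -/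
def blockGraph {k : ℕ} {R : Finset V} (φ : R ≃ (Fin k → Bool)) (i : ℕ) : SimpleGraph V :=
  SimpleGraph.fromRel fun u v => ∃ (hu : u ∈ R) (hv : v ∈ R),
    ∀ j : Fin k, i ≤ j → φ ⟨u, hu⟩ j = φ ⟨v, hv⟩ j

/-- The first step of the chain of block graphs at which the property becomes true doubles the
cliques along one coordinate `i`. The two values of this coordinate give the sides `A` and `B`, on
which bitwise translations that fix the coordinate `i` act independently. -/
theorem exists_pattern_of_card_eq {F : SimpleGraph V → Prop} (hF : Monotone F) {k : ℕ}
    {C : SimpleGraph V} {R : Finset V} (hC : IsSymmetricOn C R) (h0 : ¬ F C)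
    (h1 : F (C ⊔ cliqueOn R)) (hR : R.card = 2 ^ (k + 1)) : HasBipartitePattern F (2 ^ k) := by
  have hcard : Fintype.card R = Fintype.card (Fin (k + 1) → Bool) := by simp [hR]
  let φ : R ≃ (Fin (k + 1) → Bool) := Fintype.equivOfCardEq hcard
  have hbot : ¬ F (C ⊔ blockGraph φ 0) := by
    intro h
    refine h0 (hF (sup_le le_rfl ?_) h)
    intro u v huv
    simp only [blockGraph, SimpleGraph.fromRel_adj] at huv
    obtain ⟨hne, ⟨hu, hv, h⟩ | ⟨hu, hv, h⟩⟩ := huv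
    · exact absurd (congrArg Subtype.val (φ.injective (funext fun j => h j (Nat.zero_le _)))) hne
    · exact absurd (congrArg Subtype.val (φ.injective (funext fun j => h j (Nat.zero_le _)))).symm
        hne
  have htop : F (C ⊔ blockGraph φ (k + 1)) := by
    refine hF (sup_le_sup_left ?_ C) h1
    intro u v huv
    simp only [cliqueOn, blockGraph, SimpleGraph.fromRel_adj] at huv ⊢
    refine ⟨huv.1, Or.inl ?_⟩
    obtain ⟨hu, hv⟩ : u ∈ R ∧ v ∈ R := by tauto
    exact ⟨hu, hv, fun j hj => absurd j.2 (by omega)⟩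
  obtain ⟨i, hik, hi0, hi1⟩ : ∃ i < k + 1, ¬ F (C ⊔ blockGraph φ i) ∧
      F (C ⊔ blockGraph φ (i + 1)) := by
    by_contra! hcon
    have : ∀ i ≤ k + 1, ¬ F (C ⊔ blockGraph φ i) := by
      intro i
      induction i with
      | zero => exact fun _ => hbot
      | succ i ih => exact fun hi => hcon i hi (ih (by omega))
    exact this _ le_rfl htop
  let i' : Fin (k + 1) := ⟨i, hik⟩
  -- the two sides are given by the value of the coordinate `i`
  let side : Bool → Finset V := fun β =>
    (Finset.univ.filter fun z : Fin (k + 1) → Bool => z i' = β).map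
      (φ.symm.toEmbedding.trans (Function.Embedding.subtype _))
  have hside : ∀ β u, u ∈ side β ↔ ∃ hu : u ∈ R, φ ⟨u, hu⟩ i' = β := by
    intro β u
    simp only [side, Finset.mem_map, Finset.mem_filter, Finset.mem_univ, true_and,
      Function.Embedding.trans_apply, Equiv.coe_toEmbedding, Function.Embedding.subtype_apply]
    constructor
    · rintro ⟨z, hz, rfl⟩
      exact ⟨(φ.symm z).2, by simpa using hz⟩
    · rintro ⟨hu, h⟩
      exact ⟨φ ⟨u, hu⟩, h, by simp⟩
  have hside_card : ∀ β, (side β).card = 2 ^ k := by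
    intro β
    rw [Finset.card_map]
    have h := Fintype.card_congr ((Equiv.funSplitAt i' Bool).subtypeEquiv
      (p := fun z => z i' = β) (q := fun z => z.1 = β) fun z => by simp)
    rw [← Fintype.card_subtype, h, Fintype.card_subtype]
    have : (Finset.univ.filter fun z : Bool × ({j // j ≠ i'} → Bool) => z.1 = β)
        = {β} ×ˢ Finset.univ := by
      ext ⟨c, z⟩; simp [eq_comm]
    rw [this]
    simp
  refine ⟨side false, side true, C ⊔ blockGraph φ i, ?_, hside_card _, hside_card _, hi0, ?_, ?_⟩
  · rw [Finset.disjoint_left]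
    intro u hu hu'
    rw [hside] at hu hu'
    obtain ⟨h, h1⟩ := hu
    obtain ⟨_, h2⟩ := hu'
    rw [h1] at h2
    exact absurd h2 (by simp)
  · refine hF ?_ hi1
    rw [sup_assoc]
    refine sup_le_sup_left ?_ C
    intro u v huv
    simp only [blockGraph, SimpleGraph.fromRel_adj, SimpleGraph.sup_adj, hside] at huv ⊢
    have hmain : ∀ (hu : u ∈ R) (hv : v ∈ R),
        (∀ j : Fin (k + 1), i + 1 ≤ j → φ ⟨u, hu⟩ j = φ ⟨v, hv⟩ j) →
        φ ⟨u, hu⟩ i' = φ ⟨v, hv⟩ i' → ∀ j : Fin (k + 1), i ≤ j → φ ⟨u, hu⟩ j = φ ⟨v, hv⟩ j := by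
      intro hu hv h hi j hj
      rcases Nat.lt_or_ge i j with h' | h'
      · exact h j h'
      · have : j = i' := Fin.ext (le_antisymm h' hj)
        rw [this, hi]
    obtain ⟨hu, hv, h⟩ : ∃ (hu : u ∈ R) (hv : v ∈ R),
        ∀ j : Fin (k + 1), i + 1 ≤ j → φ ⟨u, hu⟩ j = φ ⟨v, hv⟩ j := by
      rcases huv.2 with ⟨hu, hv, h⟩ | ⟨hu, hv, h⟩
      · exact ⟨hu, hv, h⟩
      · exact ⟨hv, hu, fun j hj => (h j hj).symm⟩
    by_cases hi : φ ⟨u, hu⟩ i' = φ ⟨v, hv⟩ i'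
    · exact Or.inl ⟨huv.1, Or.inl ⟨hu, hv, hmain hu hv h hi⟩⟩
    · refine Or.inr ⟨huv.1, ?_⟩
      cases h1 : φ ⟨u, hu⟩ i' <;> cases h2 : φ ⟨v, hv⟩ i' <;> simp_all
  · intro a ha a' ha' b hb b' hb'
    rw [hside] at ha ha' hb hb'
    obtain ⟨ha, hai⟩ := ha
    obtain ⟨ha', hai'⟩ := ha'
    obtain ⟨hb, hbi⟩ := hb
    obtain ⟨hb', hbi'⟩ := hb'
    -- translate one side by `a + a'` and the other side by `b + b'`
    let s : Bool → Fin (k + 1) → Bool := fun β j =>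
      if β then xor (φ ⟨b, hb⟩ j) (φ ⟨b', hb'⟩ j) else xor (φ ⟨a, ha⟩ j) (φ ⟨a', ha'⟩ j)
    have hs : ∀ β, s β i' = false := by
      intro β
      cases β <;> simp [s, hai, hai', hbi, hbi']
    let T : (Fin (k + 1) → Bool) → (Fin (k + 1) → Bool) := fun z j => xor (z j) (s (z i') j)
    have hTi : ∀ z, T z i' = z i' := fun z => by simp [T, hs]
    have hT : Function.Involutive T := by
      intro z
      ext j
      change xor (T z j) (s (T z i') j) = z j
      rw [hTi]
      simp [T]
    let τ : Equiv.Perm R := (φ.trans hT.toPerm).trans φ.symm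
    let σ : Equiv.Perm V := Equiv.Perm.ofSubtype τ
    have hσ : ∀ u (hu : u ∈ R), σ u = (φ.symm (T (φ ⟨u, hu⟩))).1 := by
      intro u hu
      exact Equiv.Perm.ofSubtype_apply_of_mem τ hu
    have hσR : ∀ u, u ∉ R → σ u = u := fun u hu => Equiv.Perm.ofSubtype_apply_of_not_mem τ hu
    have hmem : ∀ u, σ u ∈ R ↔ u ∈ R := mem_iff_of_fixes_compl hσR
    have hφσ : ∀ u (hu : u ∈ R) (hu' : σ u ∈ R), φ ⟨σ u, hu'⟩ = T (φ ⟨u, hu⟩) := by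
      intro u hu hu'
      rw [← Equiv.eq_symm_apply]
      exact Subtype.ext (hσ u hu)
    have hblock : ∀ u v,
        (∃ (hu : σ u ∈ R) (hv : σ v ∈ R), ∀ j : Fin (k + 1), i ≤ j →
          φ ⟨σ u, hu⟩ j = φ ⟨σ v, hv⟩ j) ↔
        ∃ (hu : u ∈ R) (hv : v ∈ R), ∀ j : Fin (k + 1), i ≤ j → φ ⟨u, hu⟩ j = φ ⟨v, hv⟩ j := by
      intro u v
      constructor
      · rintro ⟨hu', hv', h⟩
        have hu := (hmem u).1 hu'
        have hv := (hmem v).1 hv'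
        refine ⟨hu, hv, fun j hj => ?_⟩
        rw [hφσ u hu, hφσ v hv] at h
        have hi := h i' le_rfl
        rw [hTi, hTi] at hi
        have := h j hj
        simp only [T, hi] at this
        simpa using this
      · rintro ⟨hu, hv, h⟩
        refine ⟨(hmem u).2 hu, (hmem v).2 hv, fun j hj => ?_⟩
        rw [hφσ u hu, hφσ v hv]
        simp only [T, h j hj, h i' le_rfl]
    have hsideσ : ∀ β u, σ u ∈ side β ↔ u ∈ side β := by
      intro β u
      rw [hside, hside]
      constructor
      · rintro ⟨hu', h⟩
        have hu := (hmem u).1 hu'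
        rw [hφσ u hu, hTi] at h
        exact ⟨hu, h⟩
      · rintro ⟨hu, h⟩
        refine ⟨(hmem u).2 hu, ?_⟩
        rw [hφσ u hu, hTi, h]
    refine ⟨σ, ?_, hsideσ _, hsideσ _, ?_, ?_⟩
    · intro u v
      simp only [SimpleGraph.sup_adj, hC σ hσR, blockGraph, SimpleGraph.fromRel_adj, ne_eq,
        σ.injective.eq_iff, hblock]
    · rw [hσ a ha]
      have : T (φ ⟨a, ha⟩) = φ ⟨a', ha'⟩ := by
        ext j
        simp [T, s, hai]
      simp [this]
    · rw [hσ b hb]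
      have : T (φ ⟨b, hb⟩) = φ ⟨b', hb'⟩ := by
        ext j
        simp [T, s, hbi]
      simp [this]

/-- Vertices of `R` are made isolated or dominating one at a time, keeping the restricted property
nontrivial, until `2 ^ (k + 1)` vertices are left or no such step is possible. -/
theorem exists_pattern_of_context {F : SimpleGraph V → Prop} (hF : Monotone F) {k : ℕ} (d : ℕ) :
    ∀ {C : SimpleGraph V} {R : Finset V}, IsSymmetricOn C R → ¬ F C → F (C ⊔ cliqueOn R) →
      R.card = 2 ^ (k + 1) + d → HasBipartitePattern F (2 ^ k) := by
  induction d with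
  | zero => exact fun hC h0 h1 hR => exists_pattern_of_card_eq hF hC h0 h1 hR
  | succ d ih =>
    intro C R hC h0 h1 hR
    by_cases hiso : ∃ c ∈ R, F (C ⊔ cliqueOn (R.erase c))
    · obtain ⟨c, hc, h⟩ := hiso
      exact ih (hC.mono (Finset.erase_subset c R)) h0 h
        (by rw [Finset.card_erase_of_mem hc, hR]; rfl)
    by_cases hdom : ∃ c ∈ R, ¬ F (C ⊔ starOn c R)
    · obtain ⟨c, hc, h⟩ := hdom
      refine ih (C := C ⊔ starOn c (R.erase c)) (R := R.erase c)
        ((hC.mono (Finset.erase_subset c R)).sup_starOn (Finset.notMem_erase c R)) ?_ ?_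
        (by rw [Finset.card_erase_of_mem hc, hR]; rfl)
      · refine fun h' => h (hF (sup_le_sup_left ?_ C) h')
        intro u v huv
        simp only [starOn, SimpleGraph.fromRel_adj, Finset.mem_erase] at huv ⊢
        tauto
      · refine hF ?_ h1
        rw [sup_assoc]
        refine sup_le_sup_left ?_ C
        intro u v huv
        simp only [starOn, cliqueOn, SimpleGraph.sup_adj, SimpleGraph.fromRel_adj,
          Finset.mem_erase] at huv ⊢
        by_cases huc : u = c
        · subst huc
          have : v ≠ u := huv.1.symm
          tauto
        · by_cases hvc : v = c
          · subst hvc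
            tauto
          · tauto
    push Not at hiso hdom
    exact exists_pattern_of_star hF (by positivity) hC hiso hdom (by rw [hR, pow_succ]; omega)

theorem exists_pattern [Fintype V] {F : SimpleGraph V → Prop} (hF : Monotone F) (h0 : ¬ F ⊥)
    (h1 : F ⊤) {k : ℕ} (hk : 2 ^ (k + 1) ≤ Fintype.card V) : HasBipartitePattern F (2 ^ k) := by
  refine exists_pattern_of_context hF (Fintype.card V - 2 ^ (k + 1)) (C := ⊥) (R := Finset.univ)
    (fun σ _ u v => by simp) h0 (hF ?_ h1) (by rw [Finset.card_univ]; omega)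
  intro u v huv
  have : u ≠ v := huv
  simp [cliqueOn, this]

end Graph

/-! ### The lower bound for monotone graph properties -/

section Main

open Classical in
/-- The adjacency bits of a graph on `Fin n`. -/
noncomputable def adjacencyBits {n : ℕ} (G : SimpleGraph (Fin n)) : VertexPair n → Bool :=
  fun e => decide (e.1 ∈ G.edgeSet)

theorem adjacencyBits_mono {n : ℕ} {G H : SimpleGraph (Fin n)} (h : G ≤ H) :
    adjacencyBits G ≤ adjacencyBits H := by
  intro e
  rw [Bool.le_iff_imp]
  simp only [adjacencyBits, decide_eq_true_eq]
  exact fun he => SimpleGraph.edgeSet_mono h he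

theorem adjacencyBits_eq_iff {n : ℕ} {G H : SimpleGraph (Fin n)} {u v u' v' : Fin n}
    (h : ¬ s(u, v).IsDiag) (h' : ¬ s(u', v').IsDiag) :
    adjacencyBits G ⟨s(u, v), h⟩ = adjacencyBits H ⟨s(u', v'), h'⟩ ↔
      (G.Adj u v ↔ H.Adj u' v') := by
  simp [adjacencyBits, SimpleGraph.mem_edgeSet]

/-- The bipartite graph between `A` and `B` with edge set `z`. -/
def bipartiteGraph {V : Type} (A B : Finset V) (z : A × B → Bool) : SimpleGraph V :=
  SimpleGraph.fromRel fun u v => ∃ (hu : u ∈ A) (hv : v ∈ B), z (⟨u, hu⟩, ⟨v, hv⟩) = true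

/-- A pattern on vertex sets of size `2 ^ k` restricts the property to a transitive function of
`4 ^ k` bits of full degree, whose sensitivity graph has spectral norm at least `2 ^ k`. -/
theorem two_pow_le_queries {n k : ℕ} {f : (VertexPair n → Bool) → Bool} (hf : IsGraphProperty f)
    (hpat : HasBipartitePattern (fun G => f (adjacencyBits G) = true) (2 ^ k))
    {Q : QuantumQueryAlgorithm (VertexPair n)} (hQ : Q.ComputesWithBoundedError f) :
    (2 : ℝ) ^ k ≤ 36 * Q.queries := by
  obtain ⟨A, B, H, hdisj, hA, hB, h0, h1, hsymm⟩ := hpat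
  have hAB : ∀ a ∈ A, ∀ b ∈ B, a ≠ b := fun a ha b hb h =>
    Finset.disjoint_left.1 hdisj ha (h ▸ hb)
  let X : (A × B → Bool) → VertexPair n → Bool := fun z =>
    adjacencyBits (H ⊔ bipartiteGraph A B z)
  let e : A × B → VertexPair n := fun p =>
    ⟨s(p.1.1, p.2.1), fun h => hAB _ p.1.2 _ p.2.2 (Sym2.mk_isDiag_iff.1 h)⟩
  have he : Function.Injective e := by
    rintro ⟨⟨a, ha⟩, ⟨b, hb⟩⟩ ⟨⟨a', ha'⟩, ⟨b', hb'⟩⟩ h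
    have h' : s(a, b) = s(a', b') := congrArg Subtype.val h
    rcases Sym2.eq_iff.1 h' with ⟨rfl, rfl⟩ | ⟨rfl, rfl⟩
    · rfl
    · exact absurd rfl (hAB a ha a hb')
  have hX : ∀ z p j, j ≠ e p → X (flipBit p z) j = X z j := by
    rintro z p ⟨j, hj⟩ hne
    induction j using Sym2.ind with
    | _ u v =>
      have hflip : ∀ (q : A × B), s(q.1.1, q.2.1) = s(u, v) → flipBit p z q = z q := by
        intro q hq
        refine flipBit_of_ne ?_ z
        rintro rfl
        exact hne (Subtype.ext hq.symm)
      rw [adjacencyBits_eq_iff]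
      have h1 : (∃ (hu : u ∈ A) (hv : v ∈ B), flipBit p z (⟨u, hu⟩, ⟨v, hv⟩) = true) ↔
          ∃ (hu : u ∈ A) (hv : v ∈ B), z (⟨u, hu⟩, ⟨v, hv⟩) = true :=
        exists_congr fun hu => exists_congr fun hv => by rw [hflip _ rfl]
      have h2 : (∃ (hu : v ∈ A) (hv : u ∈ B), flipBit p z (⟨v, hu⟩, ⟨u, hv⟩) = true) ↔
          ∃ (hu : v ∈ A) (hv : u ∈ B), z (⟨v, hu⟩, ⟨u, hv⟩) = true :=
        exists_congr fun hu => exists_congr fun hv => by rw [hflip _ Sym2.eq_swap]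
      simp only [bipartiteGraph, SimpleGraph.sup_adj, SimpleGraph.fromRel_adj, h1, h2]
  have hcard : Fintype.card (A × B) = 2 ^ (k + k) := by
    rw [Fintype.card_prod, Fintype.card_coe, Fintype.card_coe, hA, hB, pow_add]
  have hodd : Odd (Finset.univ.filter fun z => f (X z) = true).card := by
    refine odd_card_true_of_transitive hcard (fun z => f (X z)) ?_ ?_ ?_
    · rintro ⟨⟨a, ha⟩, ⟨b, hb⟩⟩ ⟨⟨a', ha'⟩, ⟨b', hb'⟩⟩
      obtain ⟨σ, hσH, hσA, hσB, rfl, rfl⟩ := hsymm a ha a' ha' b hb b' hb'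
      refine ⟨(σ.subtypePerm hσA).prodCongr (σ.subtypePerm hσB), rfl, fun z => ?_⟩
      rw [← hf σ (X z)]
      congr 1
      funext ⟨j, hj⟩
      induction j using Sym2.ind with
      | _ u v =>
        refine (adjacencyBits_eq_iff hj _).2 ?_
        have hrel : ∀ u v,
            (∃ (hu : u ∈ A) (hv : v ∈ B),
              (z ∘ (σ.subtypePerm hσA).prodCongr (σ.subtypePerm hσB)) (⟨u, hu⟩, ⟨v, hv⟩) = true) ↔
            ∃ (hu : σ u ∈ A) (hv : σ v ∈ B), z (⟨σ u, hu⟩, ⟨σ v, hv⟩) = true := fun u v =>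
          ⟨fun ⟨hu, hv, h⟩ => ⟨(hσA u).2 hu, (hσB v).2 hv, h⟩,
            fun ⟨hu, hv, h⟩ => ⟨(hσA u).1 hu, (hσB v).1 hv, h⟩⟩
        simp only [bipartiteGraph, SimpleGraph.sup_adj, SimpleGraph.fromRel_adj, hrel, hσH, ne_eq,
          σ.injective.eq_iff]
    · have : H ⊔ bipartiteGraph A B (fun _ => false) = H := by
        ext u v
        simp [bipartiteGraph]
      simpa [X, this] using h0
    · have : bipartiteGraph A B (fun _ => true) = SimpleGraph.fromRel fun u v => u ∈ A ∧ v ∈ B := by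
        ext u v
        simp [bipartiteGraph]
      simpa [X, this] using h1
  have : Nonempty (A × B) := Fintype.card_pos_iff.1 (by rw [hcard]; positivity)
  obtain ⟨v, hv, hpos, hle⟩ := exists_sensitivity_rayleigh_ge_sqrt (fun z => f (X z)) hodd
  have hadv := Q.rayleigh_le_queries hQ X e he hX v hv
  have hsqrt : Real.sqrt (Fintype.card (A × B)) = 2 ^ k := by
    rw [hcard, pow_add]
    push_cast
    exact Real.sqrt_mul_self (by positivity)
  rw [hsqrt] at hle
  exact le_of_mul_le_mul_right (hle.trans hadv) hpos

end Main

theorem theorem3 :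
    ∃ c : ℝ, 0 < c ∧ ∀ (n : ℕ) (f : (VertexPair n → Bool) → Bool),
      IsGraphProperty f → Monotone f → IsNontrivial f →
        c * (n : ℝ) ≤ (quantumQueryComplexity f : ℝ) := by
  refine ⟨1 / 144, by norm_num, fun n f hf hmono ⟨x, y, hxy⟩ => ?_⟩
  -- with fewer than two vertices there are no input bits, so `f` is constant
  have hn : 2 ≤ n := by
    by_contra hn
    have hsub : Subsingleton (Fin n) := Fin.subsingleton_iff_le_one.2 (by omega)
    have : IsEmpty (VertexPair n) := ⟨fun ⟨j, hj⟩ => by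
      induction j using Sym2.ind with
      | _ u v => exact hj (Sym2.mk_isDiag_iff.2 (Subsingleton.elim u v))⟩
    exact hxy (congrArg f (Subsingleton.elim x y))
  obtain ⟨k, hk, hk'⟩ : ∃ k, 2 ^ (k + 1) ≤ n ∧ n < 2 ^ (k + 2) := by
    have hlog : 1 ≤ Nat.log 2 n := Nat.le_log_of_pow_le (by norm_num) (by simpa using hn)
    refine ⟨Nat.log 2 n - 1, ?_, ?_⟩
    · rw [Nat.sub_add_cancel hlog]
      exact Nat.pow_log_le_self 2 (by omega)
    · rw [show Nat.log 2 n - 1 + 2 = Nat.log 2 n + 1 by omega]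
      exact Nat.lt_pow_succ_log_self (by norm_num) n
  have hF : Monotone fun G : SimpleGraph (Fin n) => f (adjacencyBits G) = true :=
    fun G H h => Bool.le_iff_imp.1 (hmono (adjacencyBits_mono h))
  have hbot : ∀ z, adjacencyBits (⊥ : SimpleGraph (Fin n)) ≤ z := fun z e => by
    simp [adjacencyBits]
  have htop : ∀ z, z ≤ adjacencyBits (⊤ : SimpleGraph (Fin n)) := fun z ⟨j, hj⟩ => by
    induction j using Sym2.ind with
    | _ u v =>
      have : u ≠ v := fun h => hj (Sym2.mk_isDiag_iff.2 h)
      simp [adjacencyBits, this, Bool.le_true]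
  have h0 : ¬ f (adjacencyBits ⊥) = true := fun h =>
    hxy ((Bool.le_iff_imp.1 (hmono (hbot x)) h).trans (Bool.le_iff_imp.1 (hmono (hbot y)) h).symm)
  have h1 : f (adjacencyBits ⊤) = true := by
    by_contra h
    have h' : ∀ z, f z = false := fun z => by
      by_contra hz
      exact h (Bool.le_iff_imp.1 (hmono (htop z)) (by simpa using hz))
    exact hxy ((h' x).trans (h' y).symm)
  have hpat := exists_pattern hF h0 h1 (k := k) (by simpa using hk)
  obtain ⟨Q, hQ, hQf⟩ := exists_algorithm_queries_eq f
  have hmain := two_pow_le_queries hf hpat hQf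
  rw [hQ] at hmain
  have hn4 : (n : ℝ) ≤ 4 * 2 ^ k := by
    have : n ≤ 4 * 2 ^ k := by rw [pow_add] at hk'; omega
    exact_mod_cast this
  linarith
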